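/- Let $G=\mathrm{Heis}(3;\mathbb R)\times\mathbb R$, with elements $(x,y,t,u)=\left(\begin{pmatrix}1&x&t\\0&1&y\\0&0&1\end{pmatrix},u\right)$, be identified with $\mathbb C^2$ through the coordinates $$z=\tfrac1{\sqrt2}(x+iy),\qquad w=t-\tfrac12xy-\tfrac i4(x^2+y^2)+iu ,$$ in which left translations are holomorphic. Let $\Gamma\subset G$ be a discrete subgroup such that the quotient $M=\Gamma\backslash G$ by left translations is compact (a primary Kodaira surface), with covering map $\pi\colon\mathbb C^2\to M$. Let $$\tilde\omega=\tfrac i2\partial\bar\partial\Phi,\qquad \Phi(z,w)=\exp\left(\tfrac14|z|^2-\tfrac i4(w-\bar w)\right)=e^{u/2},$$ be the Kähler form on the covering $\mathbb C^2$, and let $\omega$ be the locally conformally Kähler (lcK) form on $M$ with $\pi^*\omega=e^{-u/2}\tilde\omega$ (both are normalised only up to positive constant factors). Let $\omega_0=\frac i2\sum_j dz_j\wedge d\bar z_j$ be the flat Kähler form on $l^2(\mathbb C)$. For $\lambda\in\mathbb C\setminus\{0\}$ with $|\lambda|\ne1$ let $H^\infty_\lambda=(l^2(\mathbb C)\setminus\{0\})/\langle\lambda\cdot\mathrm{id}\rangle$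 be the classical Hopf manifold, with covering map $\pi_\lambda$ and lcK form $\omega_H$ given by $\pi_\lambda^*\omega_H=\|v\|^{-2}\omega_0$. An lcK map $f\colon (M,\omega)\to H^\infty_\lambda$ is a holomorphic map with $f^*\omega_H=\omega$. A map $F\colon\mathbb C^2\to l^2(\mathbb C)$ is said to induce $f\colon M\to H^\infty_\lambda$ if $F$ has no zeros and $f\circ\pi=\pi_\lambda\circ F$. Let $a>0$ and let $F\colon\mathbb C^2\to l^2(\mathbb C)$ be a Kähler map, that is, a holomorphic map with $F^*\omega_0=a\,\tilde\omega$. Then: 1. for every $\lambda\in\mathbb C\setminus\{0\}$ with $|\lambda|\neq1$ and every $b>0$, $F$ does not induce any lcK map from $(M,b\,\omega)$ to $H^\infty_\lambda$; 2. no unitary transformation or translation makes $F$ descend to the quotient: for every unitary transformation $U$ of $l^2(\mathbb C)$ and every $c\in l^2(\mathbb C)$, the map $U\circ F+c$ does not induce any map of sets $M\to H^\infty_\lambda$, for any $\lambda\in\mathbb C\setminus\{0\}$ with $|\lambda|\ne1$, and there is no map of sets $f\colon M\to l^2(\mathbb C)$ with $f\circ\pi=U\circ F+c$. -/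

import Mathlib

open Complex
open scoped InnerProductSpace

noncomputable section

namespace Kodaira

/-- The group `Heis(3; ℝ) × ℝ`; the element `⟨x, y, t, u⟩` is the pair consisting of the matrix
`!![1, x, t; 0, 1, y; 0, 0, 1]` and the real number `u`. -/
@[ext] structure HeisR where
  x : ℝ
  y : ℝ
  t : ℝ
  u : ℝ

namespace HeisR

instance : Mul HeisR := ⟨fun g h => ⟨g.x + h.x, g.y + h.y, g.t + h.t + g.x * h.y, g.u + h.u⟩⟩
instance : One HeisR := ⟨⟨0, 0, 0, 0⟩⟩
instance : Inv HeisR := ⟨fun g => ⟨-g.x, -g.y, -g.t + g.x * g.y, -g.u⟩⟩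

theorem mul_def (g h : HeisR) :
    g * h = ⟨g.x + h.x, g.y + h.y, g.t + h.t + g.x * h.y, g.u + h.u⟩ := rfl
theorem one_def : (1 : HeisR) = ⟨0, 0, 0, 0⟩ := rfl
theorem inv_def (g : HeisR) : g⁻¹ = ⟨-g.x, -g.y, -g.t + g.x * g.y, -g.u⟩ := rfl

instance : Group HeisR :=
  Group.ofLeftAxioms
    (fun a b c => by ext <;> simp only [mul_def] <;> ring)
    (fun a => by ext <;> simp [mul_def, one_def])
    (fun a => by ext <;> simp [mul_def, one_def, inv_def])

/-- The topology of `ℝ⁴`. -/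
instance : TopologicalSpace HeisR :=
  TopologicalSpace.induced (fun g => (g.x, g.y, g.t, g.u)) inferInstance

/-- The Heisenberg component as a matrix. -/
def toMatrix (g : HeisR) : Matrix (Fin 3) (Fin 3) ℝ := !![1, g.x, g.t; 0, 1, g.y; 0, 0, 1]

theorem toMatrix_mul (g h : HeisR) : (g * h).toMatrix = g.toMatrix * h.toMatrix := by
  ext i j
  fin_cases i <;> fin_cases j <;>
    simp [toMatrix, mul_def, Matrix.mul_apply, Fin.sum_univ_three] <;> ring

end HeisR

/-- The real coordinate `u` in terms of the holomorphic coordinates `(z, w)`. -/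
def uCoord (p : ℂ × ℂ) : ℝ := normSq p.1 / 2 + p.2.im

/-- The holomorphic coordinates `(z, w)` that identify `Heis(3; ℝ) × ℝ` with `ℂ²`:
`z = (x + i y) / √2` and `w = t - x y / 2 - (i / 4) (x² + y²) + i u`. -/
def coords : HeisR ≃ ℂ × ℂ where
  toFun g := (((g.x : ℂ) + I * g.y) / (Real.sqrt 2 : ℝ),
    (g.t : ℂ) - (g.x : ℂ) * g.y / 2 - I / 4 * ((g.x : ℂ) ^ 2 + (g.y : ℂ) ^ 2) + I * g.u)
  invFun p := ⟨Real.sqrt 2 * p.1.re, Real.sqrt 2 * p.1.im, p.2.re + p.1.re * p.1.im, uCoord p⟩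
  left_inv g := by
    have h2 : Real.sqrt 2 ^ 2 = 2 := Real.sq_sqrt (by norm_num)
    have h0 : Real.sqrt 2 ≠ 0 := by positivity
    ext
    · simp [div_ofReal_re]; field_simp
    · simp [div_ofReal_im]; field_simp
    · simp [div_ofReal_re, div_ofReal_im, pow_two]; field_simp; rw [h2]; ring
    · simp [uCoord, normSq_apply, pow_two]
      field_simp; ring
  right_inv p := by
    have h2 : Real.sqrt 2 ^ 2 = 2 := Real.sq_sqrt (by norm_num)
    have h0 : Real.sqrt 2 ≠ 0 := by positivity
    apply Prod.ext
    · apply Complex.ext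
      · simp [div_ofReal_re]
      · simp [div_ofReal_im]
    · apply Complex.ext
      · simp [pow_two]; linear_combination (-(p.1.re * p.1.im) / 2) * h2
      · simp [uCoord, normSq_apply, pow_two]
        linear_combination (-(p.1.re * p.1.re + p.1.im * p.1.im) / 4) * h2

/-- The compact complex surface `Γ \ (Heis(3; ℝ) × ℝ)`: orbits of left translations by `Γ`. -/
abbrev Surface (Γ : Subgroup HeisR) : Type := MulAction.orbitRel.Quotient Γ HeisR

/-- The universal covering map `ℂ² → Γ \ (Heis(3; ℝ) × ℝ)`. -/
def cover (Γ : Subgroup HeisR) (p : ℂ × ℂ) : Surface Γ :=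
  Quotient.mk (MulAction.orbitRel Γ HeisR) (coords.symm p)

/-- The real `(1,1)`-form `(i/2) ∂∂̄φ = (1/4) dd^c φ` on `ℂ²`, evaluated at the point `p` on the
tangent vectors `ξ`, `η`. Here `d^c φ = - dφ ∘ J`, so that
`dd^c φ (ξ, η) = D²φ (η, J ξ) - D²φ (ξ, J η)`. -/
def potentialForm (φ : ℂ × ℂ → ℝ) (p ξ η : ℂ × ℂ) : ℝ :=
  (1 / 4) * (fderiv ℝ (fderiv ℝ φ) p η (I • ξ) - fderiv ℝ (fderiv ℝ φ) p ξ (I • η))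

/-- The potential `Φ(z, w) = exp (|z|² / 4 - (i/4) (w - w̄)) = exp (u / 2)`. -/
def potential (p : ℂ × ℂ) : ℝ := Real.exp (uCoord p / 2)

/-- The Kähler form `(i/2) ∂∂̄Φ` on the universal covering `ℂ²`. -/
def kahlerForm (p ξ η : ℂ × ℂ) : ℝ := potentialForm potential p ξ η

/-- The lift to `ℂ²` of the locally conformally Kähler form of the surface. -/
def lckForm (p ξ η : ℂ × ℂ) : ℝ := Real.exp (-(uCoord p / 2)) * kahlerForm p ξ η

/-- The Hilbert space `l²(ℂ)`. -/
abbrev EllTwo : Type := lp (fun _ : ℕ => ℂ) 2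

/-- The flat Kähler form `(i/2) ∑ⱼ dzⱼ ∧ dz̄ⱼ` of `l²(ℂ)` on tangent vectors (the inner product is
conjugate linear in its first argument). -/
def flatForm (v w : EllTwo) : ℝ := (⟪v, w⟫_ℂ).im

/-- The pull-back of the flat Kähler form along a map `F` at the point `p`. -/
def pullback (F : ℂ × ℂ → EllTwo) (p ξ η : ℂ × ℂ) : ℝ :=
  flatForm (fderiv ℂ F p ξ) (fderiv ℂ F p η)

/-- `F` is a Kähler map from `ℂ²`, with the Kähler form `a • kahlerForm`, to `l²(ℂ)`. -/
def IsKahlerMap (a : ℝ) (F : ℂ × ℂ → EllTwo) : Prop :=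
  Differentiable ℂ F ∧ ∀ p ξ η, pullback F p ξ η = a * kahlerForm p ξ η

/-- Two nonzero vectors are equivalent if one is the other times an integer power of `lam`. -/
def hopfSetoid (lam : ℂˣ) : Setoid {v : EllTwo // v ≠ 0} :=
  (MulAction.orbitRel (Subgroup.zpowers lam) EllTwo).comap (↑)

/-- The classical Hopf manifold `(l²(ℂ) \ {0}) / ⟨lam • id⟩`. -/
def Hopf (lam : ℂˣ) : Type := Quotient (hopfSetoid lam)

/-- The covering map `l²(ℂ) \ {0} → (l²(ℂ) \ {0}) / ⟨lam • id⟩`. -/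
def hopfCover (lam : ℂˣ) (v : EllTwo) (hv : v ≠ 0) : Hopf lam :=
  Quotient.mk (hopfSetoid lam) ⟨v, hv⟩

/-- `f` is an lcK map from the surface, with the form whose lift is `b • lckForm`, to the Hopf
manifold with the form whose lift is `‖v‖⁻² • flatForm`: near every point `f` lifts to a
holomorphic map `G` on the covering spaces, and `f` pulls the second form back to the first. -/
def IsLcKMap {Γ : Subgroup HeisR} {lam : ℂˣ} (b : ℝ) (f : Surface Γ → Hopf lam) : Prop :=
  ∀ p : ℂ × ℂ, ∃ V : Set (ℂ × ℂ), IsOpen V ∧ p ∈ V ∧ ∃ G : ℂ × ℂ → EllTwo,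
    DifferentiableOn ℂ G V ∧ ∀ q ∈ V,
      (∃ hq : G q ≠ 0, f (cover Γ q) = hopfCover lam (G q) hq) ∧
      ∀ ξ η, (‖G q‖ ^ 2)⁻¹ * pullback G q ξ η = b * lckForm q ξ η

/-- `F : ℂ² → l²(ℂ)` takes values in `l²(ℂ) \ {0}` and induces `f` on the quotients. -/
def InducesToHopf {Γ : Subgroup HeisR} {lam : ℂˣ} (F : ℂ × ℂ → EllTwo)
    (f : Surface Γ → Hopf lam) : Prop :=
  ∀ p, ∃ hp : F p ≠ 0, f (cover Γ p) = hopfCover lam (F p) hp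

end Kodaira

end

/-! A Kähler map `G` is rigid on vertical lines `{z} × ℂ`. The Kähler condition gives `‖∂G/∂w‖ = (√a
/ 4) exp (|z|² / 8 + Im w / 4)`, so by Liouville `G (z, w) = exp (-i w / 4) k(z) + r(z)`
(`exists_eq_exp_smul_add`). Differencing over `4π` in `w` removes `r` and leaves a function `D`
holomorphic in `z` with `‖D z‖² = 4 a exp (|z|² / 4)`; polarized, `⟪D s', D s⟫ = 4 a exp (s * conj
s' / 4)`. Hence `D z₀` is a multiple of `D 0` only for `z₀ = 0` (`eq_zero_of_vertical_equivariant`).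
By cocompactness some element of `Γ` moves the line over `0` to the line over some `z₀ ≠ 0`, acting
by a translation in `w`. If `G` descended, its restrictions to these lines would differ by a
constant scalar (`exists_zpow_of_hopfCover_eq` in the Hopf case), making `D z₀` a multiple of `D 0`.
-/

noncomputable section

namespace Kodaira

/-! ### Polarization and Liouville for Hilbert space valued entire functions. -/

section Polarization

variable {E : Type*} [NormedAddCommGroup E] [InnerProductSpace ℂ E]

/-- An entire function vanishing on the real line vanishes identically. -/
theorem eq_zero_of_forall_ofReal {f : ℂ → ℂ} (hf : Differentiable ℂ f)
    (h0 : ∀ x : ℝ, f x = 0) (s : ℂ) : f s = 0 := by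
  have hA : AnalyticOnNhd ℂ f Set.univ := fun x _ => hf.analyticAt x
  have hZ : AnalyticOnNhd ℂ (fun _ : ℂ => (0 : ℂ)) Set.univ := fun x _ => analyticAt_const
  refine congrFun (hA.eq_of_frequently_eq (z₀ := 0) hZ ?_) s
  have ht : Filter.Tendsto (fun n : ℕ => (((1 / ((n : ℝ) + 1) : ℝ)) : ℂ)) Filter.atTop
      (nhdsWithin 0 {0}ᶜ) := by
    rw [tendsto_nhdsWithin_iff]
    refine ⟨?_, Filter.Eventually.of_forall fun n => ?_⟩
    · simpa only [ofReal_zero] using! (continuous_ofReal.tendsto 0).comp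
        (tendsto_one_div_add_atTop_nhds_zero_nat (𝕜 := ℝ))
    · have : (1 / ((n : ℝ) + 1) : ℝ) ≠ 0 := by positivity
      simpa only [Set.mem_compl_iff, Set.mem_singleton_iff, ofReal_eq_zero] using this
  exact ht.frequently (Filter.Frequently.of_forall fun n => h0 _)

/-- A function holomorphic on `ℂ²` that vanishes on the antidiagonal `σ = conj s` is zero. -/
theorem eq_zero_of_forall_conj {f : ℂ × ℂ → ℂ} (hf : Differentiable ℂ f)
    (h0 : ∀ s, f (s, starRingEnd ℂ s) = 0) (p : ℂ × ℂ) : f p = 0 := by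
  -- With `s = x + i b`, `conj s = x - i b`, the real parameters are made complex one at a time.
  have h1 : ∀ (b : ℝ) (x : ℂ), f (x + I * b, x - I * b) = 0 := fun b => by
    refine eq_zero_of_forall_ofReal (hf.comp (by fun_prop)) fun x => ?_
    convert h0 (x + I * b) using 3
    simp [sub_eq_add_neg]
  have h2 : ∀ x b : ℂ, f (x + I * b, x - I * b) = 0 := fun x =>
    eq_zero_of_forall_ofReal (hf.comp (by fun_prop)) fun b => h1 b x
  convert h2 ((p.1 + p.2) / 2) (-I * (p.1 - p.2) / 2) using 2
  ext1
  · linear_combination (p.1 - p.2) / 2 * I_mul_I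
  · linear_combination -(p.1 - p.2) / 2 * I_mul_I

/-- The map `σ ↦ ⟪m (conj σ), ·⟫` is holomorphic if `m` is. -/
theorem differentiable_inner_conj {m : ℂ → E} (hm : Differentiable ℂ m) :
    Differentiable ℂ fun p : ℂ × ℂ => ⟪m (starRingEnd ℂ p.2), m p.1⟫_ℂ := by
  have h1 : Differentiable ℂ fun s : ℂ => innerSL ℂ (m (starRingEnd ℂ s)) := fun s =>
    ((hm (starRingEnd ℂ s)).hasFDerivAt.comp_semilinear (innerSL ℂ)
      (starL ℂ : ℂ ≃L⋆[ℂ] ℂ).toContinuousLinearMap).differentiableAt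
  exact (h1.comp differentiable_snd).clm_apply (hm.comp differentiable_fst)

/-- Polarization of the norm of a holomorphic Hilbert space valued function. -/
theorem inner_eq_of_norm_sq {m : ℂ → E} (hm : Differentiable ℂ m) {N : ℂ × ℂ → ℂ}
    (hN : Differentiable ℂ N) (h : ∀ s, ((‖m s‖ ^ 2 : ℝ) : ℂ) = N (s, starRingEnd ℂ s))
    (s s' : ℂ) : ⟪m s', m s⟫_ℂ = N (s, starRingEnd ℂ s') := by
  have := eq_zero_of_forall_conj ((differentiable_inner_conj hm).sub hN)
    (fun s => by simp [← h, inner_self_eq_norm_sq_to_K]) (s, starRingEnd ℂ s')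
  simpa [sub_eq_zero] using this

/-- A primitive of a holomorphic function of norm `C * exp (y / 4)`, `y = Im w`, is a combination
of `exp (-i w / 4)` and a constant. -/
theorem exists_eq_exp_smul_add [CompleteSpace E] {h : ℂ → E} (hh : Differentiable ℂ h) {C : ℝ}
    (hC : ∀ w, ‖deriv h w‖ = C * Real.exp (w.im / 4)) :
    ∃ k r : E, ‖k‖ = 4 * C ∧ ∀ w, h w = exp (-(I * w / 4)) • k + r := by
  have hd : Differentiable ℂ (deriv h) :=
    (hh.contDiff (n := 2)).differentiable_deriv_two
  have hexp : ∀ w, ‖exp (I * w / 4)‖ = Real.exp (-(w.im / 4)) := fun w => by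
    rw [norm_exp]; congr 1; simp [neg_div]
  have hφ : Differentiable ℂ fun w => exp (I * w / 4) • deriv h w :=
    Differentiable.smul (by fun_prop) hd
  have hn : ∀ w, ‖exp (I * w / 4) • deriv h w‖ = C := fun w => by
    rw [norm_smul, hexp, hC, mul_left_comm, ← Real.exp_add]; simp
  have hb : Bornology.IsBounded (Set.range fun w => exp (I * w / 4) • deriv h w) := by
    refine isBounded_iff_forall_norm_le.2 ⟨C, ?_⟩
    rintro _ ⟨w, rfl⟩
    exact (hn w).le
  set k₀ := deriv h 0 with hk₀
  have hk : ∀ w, deriv h w = exp (-(I * w / 4)) • k₀ := fun w => by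
    have := hφ.apply_eq_apply_of_bounded hb w 0
    simp only [mul_zero, zero_div, exp_zero, one_smul] at this
    rw [hk₀, ← this, smul_smul, ← exp_add]; simp
  -- The factor `4 i` is the inverse of `-i / 4`; it gives the `4` in `‖k‖ = 4 * C`.
  have hder : ∀ w, HasDerivAt (fun w => exp (-(I * w / 4)) • ((4 * I) • k₀)) (deriv h w) w := by
    intro w
    have h1 : HasDerivAt (fun w : ℂ => exp (-(I * w / 4))) (exp (-(I * w / 4)) * (-(I * 1 / 4))) w :=
      ((((hasDerivAt_id w).const_mul I).div_const 4).neg).cexp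
    convert h1.smul_const ((4 * I) • k₀) using 1
    rw [hk, smul_smul]; congr 1
    linear_combination (exp (-(I * w / 4))) * I_mul_I
  have hz : Differentiable ℂ fun w => h w - exp (-(I * w / 4)) • ((4 * I) • k₀) :=
    hh.sub fun w => (hder w).differentiableAt
  refine ⟨(4 * I) • k₀, h 0 - exp (-(I * 0 / 4)) • ((4 * I) • k₀), ?_, fun w => ?_⟩
  · have := hn 0
    simp only [mul_zero, zero_div, exp_zero, one_smul] at this
    simp [norm_smul, hk₀, this]
  · have := is_const_of_deriv_eq_zero hz (fun w =>
      ((hh w).hasDerivAt.sub (hder w)).deriv.trans (sub_self _)) w 0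
    rw [← this]; abel

end Polarization

/-! ### The Kähler form in the vertical direction. -/

theorem uCoord_eq (p : ℂ × ℂ) : uCoord p = (p.1.re ^ 2 + p.1.im ^ 2) / 2 + p.2.im := by
  rw [uCoord, normSq_apply]; ring

theorem contDiff_potential : ContDiff ℝ 2 potential := by
  have h1 : ContDiff ℝ 2 fun p : ℂ × ℂ => p.1.re := reCLM.contDiff.comp contDiff_fst
  have h2 : ContDiff ℝ 2 fun p : ℂ × ℂ => p.1.im := imCLM.contDiff.comp contDiff_fst
  have h3 : ContDiff ℝ 2 fun p : ℂ × ℂ => p.2.im := imCLM.contDiff.comp contDiff_snd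
  have : potential = fun p =>
      Real.exp (((p.1.re ^ 2 + p.1.im ^ 2) / 2 + p.2.im) / 2) := by
    funext p; rw [potential, uCoord_eq]
  rw [this]
  exact (((((h1.pow 2).add (h2.pow 2)).div_const 2).add h3).div_const 2).exp

theorem fderiv_potential (p : ℂ × ℂ) (v : ℂ) :
    fderiv ℝ potential p (0, v) = v.im / 2 * potential p := by
  have hd : HasFDerivAt potential (fderiv ℝ potential p) (p + (0 : ℝ) • ((0, v) : ℂ × ℂ)) := by
    simpa using (contDiff_potential.differentiable (by norm_num) p).hasFDerivAt
  have hl : HasDerivAt (fun s : ℝ => p + s • ((0, v) : ℂ × ℂ)) (0, v) 0 := by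
    simpa using ((hasDerivAt_id (0 : ℝ)).smul_const ((0, v) : ℂ × ℂ)).const_add p
  refine (hd.comp_hasDerivAt (0 : ℝ) hl).unique ?_
  have he : potential ∘ (fun s : ℝ => p + s • ((0, v) : ℂ × ℂ)) =
      fun s => Real.exp (uCoord p / 2 + s * (v.im / 2)) := by
    funext s
    simp [potential, uCoord]; ring
  rw [he]
  have := (((hasDerivAt_id (0 : ℝ)).mul_const (v.im / 2)).const_add (uCoord p / 2)).exp
  simpa [potential, mul_comm] using this

theorem fderiv_fderiv_potential (p : ℂ × ℂ) (v v' : ℂ) :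
    fderiv ℝ (fderiv ℝ potential) p (0, v) (0, v') = v.im * v'.im / 4 * potential p := by
  have hd : DifferentiableAt ℝ (fderiv ℝ potential) p :=
    (contDiff_potential.fderiv_right (m := 1) (by norm_num)).differentiable (by norm_num) p
  have h1 : fderiv ℝ (fun q => fderiv ℝ potential q (0, v')) p (0, v) =
      fderiv ℝ (fderiv ℝ potential) p (0, v) (0, v') := by
    rw [fderiv_clm_apply hd (differentiableAt_const _)]; simp
  rw [← h1]
  simp only [fderiv_potential]
  rw [fderiv_const_mul (contDiff_potential.differentiable (by norm_num) p)]
  simp [fderiv_potential]; ring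

theorem kahlerForm_vertical (p : ℂ × ℂ) : kahlerForm p (0, 1) (0, I) = potential p / 16 := by
  simp [kahlerForm, potentialForm, fderiv_fderiv_potential]; ring

/-! ### Rigidity of Kähler maps on vertical lines. -/

namespace IsKahlerMap

variable {a : ℝ} {G : ℂ × ℂ → EllTwo}

/-- Translations do not change the derivative and `U` preserves the inner product, so `U ∘ F + c`
needs no separate treatment. -/
theorem unitary_add_const (hG : IsKahlerMap a G) (U : EllTwo ≃ₗᵢ[ℂ] EllTwo) (c : EllTwo) :
    IsKahlerMap a fun p => U (G p) + c := by
  refine ⟨(U.toContinuousLinearEquiv.differentiable.comp hG.1).add_const c, fun p ξ η => ?_⟩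
  have h : fderiv ℂ (fun p => U (G p) + c) p =
      (U.toContinuousLinearEquiv : EllTwo →L[ℂ] EllTwo).comp (fderiv ℂ G p) :=
    ((U.toContinuousLinearEquiv.hasFDerivAt.comp p (hG.1 p).hasFDerivAt).add_const c).fderiv
  rw [← hG.2 p ξ η, pullback, pullback, h, flatForm, flatForm]
  exact congrArg Complex.im (U.inner_map_map _ _)

theorem norm_deriv_vertical (hG : IsKahlerMap a G) (ha : 0 < a) (z w : ℂ) :
    ‖deriv (fun w => G (z, w)) w‖ =
      Real.sqrt a / 4 * Real.exp (‖z‖ ^ 2 / 8) * Real.exp (w.im / 4) := by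
  have hd : deriv (fun w => G (z, w)) w = fderiv ℂ G (z, w) (0, 1) :=
    ((hG.1 (z, w)).hasFDerivAt.comp_hasDerivAt w
      ((hasDerivAt_const w z).prodMk (hasDerivAt_id w))).deriv
  have hI : fderiv ℂ G (z, w) (0, I) = I • fderiv ℂ G (z, w) (0, 1) := by
    rw [← map_smul]; simp
  have h := hG.2 (z, w) (0, 1) (0, I)
  rw [pullback, flatForm, hI, inner_smul_right, inner_self_eq_norm_sq_to_K,
    kahlerForm_vertical, ← hd] at h
  refine (sq_eq_sq₀ (norm_nonneg _) (by positivity)).1 ?_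
  have h' : ‖deriv (fun w => G (z, w)) w‖ ^ 2 = a * (potential (z, w) / 16) := by
    rw [← h]; simp [← ofReal_pow]
  rw [h', mul_pow, mul_pow, ← Real.exp_nat_mul, ← Real.exp_nat_mul, div_pow, Real.sq_sqrt ha.le,
    mul_assoc, ← Real.exp_add, potential, uCoord, normSq_eq_norm_sq]
  push_cast
  ring_nf

theorem sub_vertical (hG : IsKahlerMap a G) (ha : 0 < a) (z : ℂ) :
    ‖G (z, 4 * Real.pi) - G (z, 0)‖ = 2 * Real.sqrt a * Real.exp (‖z‖ ^ 2 / 8) ∧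
    ∀ w, G (z, w + 4 * Real.pi) - G (z, w) =
      exp (-(I * w / 4)) • (G (z, 4 * Real.pi) - G (z, 0)) := by
  obtain ⟨k, r, hk, h⟩ := exists_eq_exp_smul_add (h := fun w => G (z, w))
    (hG.1.comp ((differentiable_const z).prodMk differentiable_id))
    (hG.norm_deriv_vertical ha z)
  have hw : ∀ w, G (z, w + 4 * Real.pi) - G (z, w) = (-2 * exp (-(I * w / 4))) • k := fun w => by
    -- `4π` is half a period of the exponential: the sign flips, so the difference is `-2` times the
    -- exponential term.
    have he : exp (-(I * (w + 4 * Real.pi) / 4)) = -exp (-(I * w / 4)) := by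
      rw [show -(I * (w + 4 * Real.pi) / 4) = -(I * w / 4) - Real.pi * I by ring, exp_sub,
        exp_pi_mul_I, div_neg, div_one]
    have h1 := h (w + 4 * Real.pi)
    have h2 := h w
    rw [h1, h2, he]
    module
  have h0 : G (z, 4 * Real.pi) - G (z, 0) = (-2 : ℂ) • k := by simpa using hw 0
  refine ⟨?_, fun w => ?_⟩
  · rw [h0, norm_smul, hk]; simp; ring
  · rw [h0, hw, smul_smul, mul_comm]

/-- A Kähler map is not equivariant up to a scalar along two different vertical lines. -/
theorem eq_zero_of_vertical_equivariant (hG : IsKahlerMap a G) (ha : 0 < a) {z₀ w₀ μ : ℂ}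
    (h : ∀ w, G (z₀, w₀ + w) = μ • G (0, w)) : z₀ = 0 := by
  set D : ℂ → EllTwo := fun z => G (z, 4 * Real.pi) - G (z, 0) with hD
  have hDd : Differentiable ℂ D :=
    (hG.1.comp (differentiable_id.prodMk (differentiable_const _))).sub
      (hG.1.comp (differentiable_id.prodMk (differentiable_const _)))
  have hn : ∀ z, ‖D z‖ = 2 * Real.sqrt a * Real.exp (‖z‖ ^ 2 / 8) :=
    fun z => (hG.sub_vertical ha z).1
  have hpol : ∀ s s', ⟪D s', D s⟫_ℂ = 4 * a * exp (s * starRingEnd ℂ s' / 4) := fun s s' => by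
    refine inner_eq_of_norm_sq hDd (N := fun p => 4 * a * exp (p.1 * p.2 / 4)) (by fun_prop)
      (fun s => ?_) s s'
    have h1 : ‖D s‖ ^ 2 = 4 * a * Real.exp (‖s‖ ^ 2 / 4) := by
      rw [hn, mul_pow, mul_pow, Real.sq_sqrt ha.le, ← Real.exp_nat_mul]
      push_cast; ring_nf
    rw [h1, mul_conj, normSq_eq_norm_sq]; push_cast; ring
  obtain ⟨ν, hν⟩ : ∃ ν : ℂ, D z₀ = ν • D 0 := by
    refine ⟨(exp (-(I * w₀ / 4)))⁻¹ * μ, ?_⟩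
    have h2 := (hG.sub_vertical ha z₀).2 w₀
    have h3 := h 0
    rw [add_zero] at h3
    rw [h, h3, ← smul_sub] at h2
    rw [mul_smul, h2, inv_smul_smul₀ (exp_ne_zero _)]
  have ha' : (4 * a : ℂ) ≠ 0 := by simpa using ha.ne'
  -- `⟪D 0, D z⟫ = 4 a` for every `z`, which forces `ν = 1`; the norms then differ unless `z₀ = 0`.
  have e1 : ν = 1 := by
    have := hpol z₀ 0
    rw [hν, inner_smul_right, hpol] at this
    simpa [ha.ne'] using this
  by_contra hz
  have e2 := hn z₀
  rw [hν, e1, one_smul, hn] at e2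
  have : (0 : ℝ) ^ 2 / 8 = ‖z₀‖ ^ 2 / 8 := by
    simpa only [norm_zero] using Real.exp_injective
      (mul_left_cancel₀ (by positivity : 2 * Real.sqrt a ≠ 0) e2)
  have : 0 < ‖z₀‖ := norm_pos_iff.2 hz
  nlinarith

end IsKahlerMap

/-! ### The action of `Γ` on vertical lines. -/

/-- The points `(0, w)` are the elements with `x = y = 0`, which are central, so no shear term
appears. -/
theorem coords_mul_vertical (g : HeisR) (w : ℂ) :
    coords (g * coords.symm (0, w)) = ((coords g).1, (coords g).2 + w) := by
  refine Prod.ext ?_ ?_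
  · simp [coords, HeisR.mul_def]
  · simp [coords, HeisR.mul_def, uCoord]
    linear_combination re_add_im w

theorem cover_smul (Γ : Subgroup HeisR) (g : Γ) (p : ℂ × ℂ) :
    cover Γ (coords (g * coords.symm p)) = cover Γ p := by
  refine Quotient.sound ?_
  rw [Equiv.symm_apply_apply]
  exact ⟨g, rfl⟩

theorem cover_vertical (Γ : Subgroup HeisR) (g : Γ) (w : ℂ) :
    cover Γ ((coords g).1, (coords g).2 + w) = cover Γ (0, w) := by
  rw [← coords_mul_vertical, cover_smul]

/-- A cocompact subgroup of `Heis(3; ℝ) × ℝ` projects nontrivially to the `x` coordinate. -/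
theorem exists_x_ne_zero (Γ : Subgroup HeisR) [CompactSpace (Surface Γ)] :
    ∃ g : Γ, (g : HeisR).x ≠ 0 := by
  by_contra! h0
  have hx : Continuous HeisR.x := 
    continuous_fst.comp (continuous_induced_dom (f := fun g : HeisR => (g.x, g.y, g.t, g.u)))
  -- Were `x` zero on `Γ`, it would descend to an unbounded continuous function on a compact space.
  let X : Surface Γ → ℝ := Quotient.lift HeisR.x (by
    rintro _ b ⟨g, rfl⟩
    change (g : HeisR).x + b.x = b.x
    rw [h0, zero_add])
  have hX : Continuous X := hx.quotient_lift _
  obtain ⟨C, hC⟩ := (isCompact_range hX).bddAbove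
  have : C + 1 ≤ C := hC ⟨Quotient.mk _ ⟨C + 1, 0, 0, 0⟩, rfl⟩
  linarith

theorem exists_fst_coords_ne_zero (Γ : Subgroup HeisR) [CompactSpace (Surface Γ)] :
    ∃ g : Γ, (coords g).1 ≠ 0 := by
  obtain ⟨g, hg⟩ := exists_x_ne_zero Γ
  refine ⟨g, fun h => hg ?_⟩
  have := congrArg HeisR.x (coords.symm_apply_apply (g : HeisR))
  rw [← this]
  change Real.sqrt 2 * (coords g).1.re = 0
  rw [h, zero_re, mul_zero]

/-! ### Lifting equalities from the Hopf manifold, and the obstruction. -/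

theorem hopfCover_eq_iff {lam : ℂˣ} {v v' : EllTwo} (hv : v ≠ 0) (hv' : v' ≠ 0) :
    hopfCover lam v hv = hopfCover lam v' hv' ↔ ∃ n : ℤ, v = (lam : ℂ) ^ n • v' := by
  refine (Quotient.eq (r := hopfSetoid lam)).trans ?_
  change (∃ g : Subgroup.zpowers lam, g • v' = v) ↔ _
  constructor
  · rintro ⟨⟨_, n, rfl⟩, h⟩
    refine ⟨n, h.symm.trans ?_⟩
    rw [← Units.val_zpow_eq_zpow_val]; rfl
  · rintro ⟨n, h⟩
    refine ⟨⟨lam ^ n, n, rfl⟩, ?_⟩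
    rw [h, ← Units.val_zpow_eq_zpow_val]; rfl

/-- Two continuous families of nonzero vectors with the same image in the Hopf manifold differ by
a constant power of `lam`. -/
theorem exists_zpow_of_hopfCover_eq {X : Type*} [TopologicalSpace X] [PreconnectedSpace X]
    [Nonempty X] {lam : ℂˣ} (hlam : ‖(lam : ℂ)‖ ≠ 1) {A B : X → EllTwo} (hA : Continuous A)
    (hB : Continuous B) (hA0 : ∀ x, A x ≠ 0) (hB0 : ∀ x, B x ≠ 0)
    (h : ∀ x, hopfCover lam (A x) (hA0 x) = hopfCover lam (B x) (hB0 x)) :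
    ∃ n : ℤ, ∀ x, A x = (lam : ℂ) ^ n • B x := by
  choose k hk using fun x => (hopfCover_eq_iff (hA0 x) (hB0 x)).1 (h x)
  have hl : Real.log ‖(lam : ℂ)‖ ≠ 0 :=
    Real.log_ne_zero_of_pos_of_ne_one (norm_pos_iff.2 lam.ne_zero) hlam
  -- As `|lam| ≠ 1`, the norms determine the exponent; it is thus continuous and integer valued,
  -- hence constant.
  have hkr : ∀ x, ((k x : ℤ) : ℝ) =
      (Real.log ‖A x‖ - Real.log ‖B x‖) / Real.log ‖(lam : ℂ)‖ := fun x => by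
    have h1 : Real.log ‖A x‖ = k x * Real.log ‖(lam : ℂ)‖ + Real.log ‖B x‖ := by
      conv_lhs => rw [hk x]
      rw [norm_smul, norm_zpow, Real.log_mul
        (zpow_ne_zero _ (norm_ne_zero_iff.2 lam.ne_zero)) (norm_ne_zero_iff.2 (hB0 x)),
        Real.log_zpow]
    rw [h1, add_sub_cancel_right, mul_div_cancel_right₀ _ hl]
  have hkc : Continuous k := by
    rw [Int.isClosedEmbedding_coe_real.isEmbedding.continuous_iff]
    refine Continuous.congr ?_ fun x => (hkr x).symm
    exact ((hA.norm.log fun x => norm_ne_zero_iff.2 (hA0 x)).sub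
      (hB.norm.log fun x => norm_ne_zero_iff.2 (hB0 x))).div_const _
  obtain ⟨x₀⟩ := ‹Nonempty X›
  refine ⟨k x₀, fun x => ?_⟩
  rw [← isPreconnected_univ.constant hkc.continuousOn (Set.mem_univ x) (Set.mem_univ x₀)]
  exact hk x

theorem IsKahlerMap.not_inducesToHopf {Γ : Subgroup HeisR} [CompactSpace (Surface Γ)] {a : ℝ}
    (ha : 0 < a) {G : ℂ × ℂ → EllTwo} (hG : IsKahlerMap a G) {lam : ℂˣ} (hlam : ‖(lam : ℂ)‖ ≠ 1)
    (f : Surface Γ → Hopf lam) : ¬ InducesToHopf G f := by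
  intro hf
  choose h0 hf using hf
  obtain ⟨g, hg⟩ := exists_fst_coords_ne_zero Γ
  obtain ⟨n, hn⟩ := exists_zpow_of_hopfCover_eq hlam
    (A := fun w : ℂ => G ((coords g).1, (coords g).2 + w)) (B := fun w : ℂ => G (0, w))
    (hG.1.continuous.comp (by fun_prop)) (hG.1.continuous.comp (by fun_prop))
    (fun w => h0 _) (fun w => h0 _) (fun w => by rw [← hf, ← hf, cover_vertical])
  exact hg (hG.eq_zero_of_vertical_equivariant ha hn)

theorem IsKahlerMap.not_factors_cover {Γ : Subgroup HeisR} [CompactSpace (Surface Γ)] {a : ℝ}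
    (ha : 0 < a) {G : ℂ × ℂ → EllTwo} (hG : IsKahlerMap a G) (f : Surface Γ → EllTwo) :
    ¬ ∀ p, f (cover Γ p) = G p := by
  intro hf
  obtain ⟨g, hg⟩ := exists_fst_coords_ne_zero Γ
  refine hg (hG.eq_zero_of_vertical_equivariant ha (w₀ := (coords g).2) (μ := 1) fun w => ?_)
  rw [← hf, ← hf, cover_vertical, one_smul]

end Kodaira

end

theorem mainTheorem11 (Γ : Subgroup Kodaira.HeisR) (hdiscrete : DiscreteTopology Γ)
    (hcompact : CompactSpace (Kodaira.Surface Γ)) (a : ℝ) (ha : 0 < a)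
    (F : ℂ × ℂ → Kodaira.EllTwo) (hF : Kodaira.IsKahlerMap a F) :
    (∀ lam : ℂˣ, ‖(lam : ℂ)‖ ≠ 1 → ∀ b : ℝ, 0 < b →
      ¬ ∃ f : Kodaira.Surface Γ → Kodaira.Hopf lam,
        Kodaira.IsLcKMap b f ∧ Kodaira.InducesToHopf F f) ∧
    ∀ (U : Kodaira.EllTwo ≃ₗᵢ[ℂ] Kodaira.EllTwo) (c : Kodaira.EllTwo),
      (∀ lam : ℂˣ, ‖(lam : ℂ)‖ ≠ 1 →
        ¬ ∃ f : Kodaira.Surface Γ → Kodaira.Hopf lam,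
          Kodaira.InducesToHopf (fun p => U (F p) + c) f) ∧
      ¬ ∃ f : Kodaira.Surface Γ → Kodaira.EllTwo,
        ∀ p, f (Kodaira.cover Γ p) = U (F p) + c := by
  refine ⟨fun lam hlam b _ => ?_, fun U c => ⟨fun lam hlam => ?_, ?_⟩⟩
  · rintro ⟨f, -, hf⟩
    exact hF.not_inducesToHopf ha hlam f hf
  · rintro ⟨f, hf⟩
    exact (hF.unitary_add_const U c).not_inducesToHopf ha hlam f hf
  · rintro ⟨f, hf⟩
    exact (hF.unitary_add_const U c).not_factors_cover ha f hf
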